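/- Let $n\ge 0$ and let $f:\{0,1\}^n\to\{0,1\}$ be an $n$-bit Boolean function. Then $Q_E(f)=n$ if and only if $f$ is isomorphic to $\mathrm{AND}_n$. Here $\mathrm{AND}_n(x)=1$ iff $x_1=\dots=x_n=1$. Two $n$-bit Boolean functions $f,g$ are isomorphic (NPN-equivalent) if they are equal up to permuting the input variables, negating some of the input variables, and possibly negating the output; that is, there are a permutation $\sigma$ of $\{1,\dots,n\}$, bits $a_1,\dots,a_n\in\{0,1\}$ and $c\in\{0,1\}$ such that $f(x)=c\oplus g(a_1\oplus x_{\sigma(1)},\dots,a_n\oplus x_{\sigma(n)})$ for all $x$. A quantum algorithm with $t$ queries works in a finite-dimensional complex Hilbert space with a fixed orthonormal standard basis, each element of which corresponds to exactly one or to none of the input bits. It applies $U_1,Q,U_2,Q,\dots,U_t,Q,U_{t+1}$ (in this order) to a fixed unit starting vector, where the $U_j$ are unitaries that do not depend on the input $x$, and $Q$ multiplies a basis state corresponding to the $i$-th bit by $(-1)^{x_i}$ and fixes a basis state corresponding to no bit. Then it measures in the standard basis and outputs a bit determined by the measured basis state. It computes $f$ exactly if for every $x\in\{0,1\}^n$ the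 output equals $f(x)$ with probability $1$. The exact quantum query complexity $Q_E(f)$ is the least $t$ for which some algorithm with $t$ queries computes $f$ exactly. -/

import Mathlib

/-- `n`-bit (total) Boolean functions. -/
abbrev BoolFun (n : ℕ) : Type := (Fin n → Bool) → Bool

/-- The function `AND_n`: it is `1` exactly on the all-ones input. -/
def andFun (n : ℕ) : BoolFun n := fun x => decide (∀ i, x i = true)

/-- Query-isomorphism (NPN-equivalence): `f` is obtained from `g` by permuting the input variables
(`σ`), negating some of them (those with `a i = true`), and possibly negating the output
(if `c = true`). -/
def QueryIsomorphic {n : ℕ} (f g : BoolFun n) : Prop :=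
  ∃ (σ : Equiv.Perm (Fin n)) (a : Fin n → Bool) (c : Bool),
    ∀ x : Fin n → Bool, f x = xor c (g fun i => xor (a i) (x (σ i)))

/-- A quantum query algorithm on `n` input bits. Its Hilbert space is `State → ℂ` with the standard
inner product, and `State` indexes the standard basis. -/
structure QueryAlgorithm (n : ℕ) where
  /-- labels of the standard basis states -/
  State : Type
  [fintypeState : Fintype State]
  [decEqState : DecidableEq State]
  /-- the input bit to which a basis state corresponds; `none` if it corresponds to no input bit -/
  bit : State → Option (Fin n)
  /-- the fixed starting state, a unit vector -/
  start : State → ℂ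
  start_norm : ∑ s, ‖start s‖ ^ 2 = 1
  /-- the number of applications of the query transformation -/
  queries : ℕ
  /-- the input-independent unitaries; only `U 0, …, U queries` are used -/
  U : ℕ → Matrix.unitaryGroup State ℂ
  /-- the value that is output when the final measurement gives the basis state `s` -/
  output : State → Bool

namespace QueryAlgorithm

attribute [instance] QueryAlgorithm.fintypeState QueryAlgorithm.decEqState

variable {n : ℕ} (A : QueryAlgorithm n)

/-- The eigenvalue of the query transformation at the basis state `s` on input `x`:
`(-1) ^ (x i)` if `s` corresponds to the input bit `i`, and `1` if it corresponds to none. -/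
def phase (x : Fin n → Bool) (s : A.State) : ℂ :=
  match A.bit s with
  | none => 1
  | some i => if x i then -1 else 1

/-- The query transformation on input `x`. -/
def query (x : Fin n → Bool) (ψ : A.State → ℂ) : A.State → ℂ :=
  fun s => A.phase x s * ψ s

/-- The state on input `x` after `k` queries, each followed by the next unitary:
`U k · Q · U (k-1) · Q ⋯ Q · U 0` applied to the starting state. -/
def stateAfter (x : Fin n → Bool) : ℕ → A.State → ℂ
  | 0 => (A.U 0 : Matrix A.State A.State ℂ).mulVec A.start
  | k + 1 => (A.U (k + 1) : Matrix A.State A.State ℂ).mulVec (A.query x (stateAfter x k))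

/-- The probability that the algorithm outputs `b` on input `x`: the final state is measured in the
standard basis. -/
noncomputable def outputProb (x : Fin n → Bool) (b : Bool) : ℝ :=
  ∑ s with A.output s = b, ‖A.stateAfter x A.queries s‖ ^ 2

/-- The algorithm computes `f` exactly: on every input it outputs the correct value with
certainty. -/
def ComputesExactly (f : BoolFun n) : Prop :=
  ∀ x, A.outputProb x (f x) = 1

end QueryAlgorithm

/-- The exact quantum query complexity: the least number of queries of an algorithm that computes
`f` exactly. (An infimum in `ℕ∞`, which is attained whenever it is finite.) -/
noncomputable def exactQuantumQueryComplexity {n : ℕ} (f : BoolFun n) : ℕ∞ :=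
  ⨅ (A : QueryAlgorithm n) (_ : A.ComputesExactly f), (A.queries : ℕ∞)

/-!
Unitaries that do not depend on the input preserve the Gram matrix of the states on all inputs, and
any two families of states with the same Gram matrix are related by such a unitary. So the power of
an algorithm is described by Gram matrices alone: a query decomposes the Gram matrix according to
the labels of the basis states and multiplies each part by the signs of its label. In particular
one query computes the exclusive or of two input bits, and `n` queries always suffice.

Lower bound: after `t` queries all amplitudes are polynomials of degree at most `t` in the signs
`(-1) ^ x i`. If `f` takes some value only at `p`, an amplitude at a basis state with that output
vanishes at all inputs except possibly `p`, and such a nonzero function on the cube has degree `n`.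

Upper bound: suppose that `f` takes neither of its values exactly once. If `f` takes the value `1`
an even number of times, then some `x i` or `x i ^^ x j` splits the cube into halves on which this
number is even again, and asking for it leads to a constant function after `n - 1` queries. If
`n = 3` and the number is odd, then up to a translation `f` is the indicator function of `000` plus
a nonconstant affine function, for which a query in a uniform superposition of the four labels
leaves exclusive ors of two bits. If `4 ≤ n`, then for some query `x i` or `x i ^^ x j` the function
still takes neither of its values exactly once on either half of the cube. Otherwise there would be
a value `v` that is taken exactly once on one of the halves for each such query; by counting, `v`
would be taken three times in all, but these inputs would include a different one for each `x i`.
-/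

section GramMatrices

open Matrix

variable {m n : ℕ}

/-- The bit of `x` that is read at a basis state with label `o`. The label `none` stands for no
input bit and reads `false`, so that it behaves as a constant input bit. -/
def queryBit (x : Fin n → Bool) (o : Option (Fin n)) : Bool := o.elim false x

/-- The real eigenvalue of the query transformation on input `x` at a basis state with label `o`. -/
def querySign (x : Fin n → Bool) (o : Option (Fin n)) : ℝ := if queryBit x o then -1 else 1

/-- Real matrices indexed by pairs of inputs, of which the Gram matrices of families of states
`(ψ x)`, one state for each input `x`, are examples. -/
abbrev InputMatrix (n : ℕ) : Type := Matrix (Fin n → Bool) (Fin n → Bool) ℝ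

/-- `GramSolvable f t G` says that states whose Gram matrix is `G` can be turned, with `t` queries,
into states that are orthogonal on inputs with different values of `f`. Unitaries do not change a
Gram matrix, so a query is described by the Gram matrices `M o` of the components of the states on
the basis states with label `o`. -/
def GramSolvable (f : BoolFun n) : ℕ → InputMatrix n → Prop
  | 0, G => ∀ x y, f x ≠ f y → G x y = 0
  | t + 1, G => ∃ M : Option (Fin n) → InputMatrix n,
      (∀ o, (M o).PosSemidef) ∧ ∑ o, M o = G ∧
        GramSolvable f t (∑ o, vecMulVec (querySign · o) (querySign · o) ⊙ M o)

/-- Solvability of `f` with `t` queries from a common unit starting vector, in terms of Gram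
matrices: the Gram matrix of the constant family is the all-ones matrix. -/
def GramComputable (f : BoolFun n) (t : ℕ) : Prop := GramSolvable f t (of fun _ _ => 1)

theorem posSemidef_vecMulVec_hadamard {X : Type*} [Finite X] {M : Matrix X X ℝ}
    (hM : M.PosSemidef) (d : X → ℝ) : (vecMulVec d d ⊙ M).PosSemidef :=
  PosSemidef.hadamard (by simpa using posSemidef_vecMulVec_self_star d) hM

theorem posSemidef_of_one {X : Type*} [Finite X] :
    (of fun _ _ => 1 : Matrix X X ℝ).PosSemidef := by
  convert posSemidef_vecMulVec_self_star (1 : X → ℝ) using 1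
  ext
  simp [vecMulVec_apply]

/-- The states are direct sums of branches, the branch `b` having amplitude `d b x` on input `x`,
and the branches are processed in parallel. -/
theorem GramSolvable.sum_vecMulVec_hadamard {B : Type*} [Fintype B] {f : BoolFun n}
    {g : B → BoolFun n} {d : B → (Fin n → Bool) → ℝ} (hd : ∀ b x, d b x ≠ 0 → f x = g b x)
    {t : ℕ} {G : B → InputMatrix n} (h : ∀ b, GramSolvable (g b) t (G b)) :
    GramSolvable f t (∑ b, vecMulVec (d b) (d b) ⊙ G b) := by
  induction t generalizing G with
  | zero =>
    intro x y hxy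
    simp only [Matrix.sum_apply, hadamard_apply, vecMulVec_apply]
    refine Finset.sum_eq_zero fun b _ => ?_
    by_cases hx : d b x = 0
    · simp [hx]
    by_cases hy : d b y = 0
    · simp [hy]
    rw [h b x y (by rwa [← hd b x hx, ← hd b y hy]), mul_zero]
  | succ t ih =>
    choose M hM hsum hsolv using h
    refine ⟨fun o => ∑ b, vecMulVec (d b) (d b) ⊙ M b o, fun o =>
      posSemidef_sum _ fun b _ => posSemidef_vecMulVec_hadamard (hM b o) _, ?_, ?_⟩
    · rw [Finset.sum_comm]
      ext x y
      simp only [← hsum, Matrix.sum_apply, hadamard_apply, Finset.mul_sum]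
    · convert ih hsolv using 1
      ext x y
      simp only [Matrix.sum_apply, hadamard_apply, Finset.mul_sum]
      rw [Finset.sum_comm]
      exact Finset.sum_congr rfl fun b _ => Finset.sum_congr rfl fun o _ => mul_left_comm _ _ _

theorem GramComputable.of_const {f : BoolFun n} (h : ∀ x y, f x = f y) : GramComputable f 0 :=
  fun x y hxy => absurd (h x y) hxy

/-- The input in which the bit `j` is the bit of `x` with label `τ j`, negated if `a j` holds. -/
def substitute (a : Fin m → Bool) (τ : Fin m → Option (Fin n)) (x : Fin n → Bool) : Fin m → Bool :=
  fun j => a j ^^ queryBit x (τ j)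

theorem querySign_substitute (a : Fin m → Bool) (τ : Fin m → Option (Fin n)) (x : Fin n → Bool)
    (o : Option (Fin m)) :
    querySign (substitute a τ x) o = querySign a o * querySign x (o.bind τ) := by
  cases o with
  | none => simp [querySign, queryBit]
  | some j => cases h : a j <;> cases h' : queryBit x (τ j) <;>
      simp [querySign, substitute, queryBit.eq_def _ (some j), h, h']

theorem querySign_mul_self (x : Fin n → Bool) (o : Option (Fin n)) :
    querySign x o * querySign x o = 1 := by
  unfold querySign
  split_ifs <;> norm_num

theorem GramSolvable.comp_substitute {g : BoolFun m} {t : ℕ} {G : InputMatrix m}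
    (h : GramSolvable g t G) (a : Fin m → Bool) (τ : Fin m → Option (Fin n)) :
    GramSolvable (g ∘ substitute a τ) t (G.submatrix (substitute a τ) (substitute a τ)) := by
  induction t generalizing G with
  | zero => exact fun x y hxy => h _ _ hxy
  | succ t ih =>
    obtain ⟨M, hM, hsum, hsolv⟩ := h
    refine ⟨fun k => ∑ o with o.bind τ = k, (M o).submatrix (substitute a τ) (substitute a τ),
      fun k => posSemidef_sum _ fun o _ => (hM o).submatrix _, ?_, ?_⟩
    · rw [Finset.sum_fiberwise]
      ext x y
      simp only [← hsum, Matrix.sum_apply, submatrix_apply]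
    · convert ih hsolv using 1
      ext x y
      simp only [Matrix.sum_apply, hadamard_apply, vecMulVec_apply, submatrix_apply, Finset.mul_sum]
      rw [← Finset.sum_fiberwise _ (fun o : Option (Fin m) => o.bind τ)]
      refine Finset.sum_congr rfl fun k _ => Finset.sum_congr rfl fun o ho => ?_
      rw [← (Finset.mem_filter.1 ho).2, querySign_substitute, querySign_substitute]
      linear_combination (-querySign x (o.bind τ) * querySign y (o.bind τ) *
        M o (substitute a τ x) (substitute a τ y)) * querySign_mul_self a o

theorem GramComputable.comp_substitute {g : BoolFun m} {t : ℕ} (h : GramComputable g t)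
    (a : Fin m → Bool) (τ : Fin m → Option (Fin n)) :
    GramComputable (g ∘ substitute a τ) t :=
  GramSolvable.comp_substitute h a τ

theorem sum_mul_div_card_eq_add_sum_sub_mul_sub {κ : Type*} [Fintype κ] [Nonempty κ]
    (v w : κ → ℝ) :
    (∑ k, v k * w k) / Fintype.card κ =
      (∑ k, v k) / Fintype.card κ * ((∑ k, w k) / Fintype.card κ) +
        ∑ k, ∑ l, (v k - v l) / (√2 * Fintype.card κ) * ((w k - w l) / (√2 * Fintype.card κ)) := by
  have hcard : (Fintype.card κ : ℝ) ≠ 0 := by exact_mod_cast Fintype.card_ne_zero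
  have hterm : ∀ k l, (v k - v l) / (√2 * Fintype.card κ) * ((w k - w l) / (√2 * Fintype.card κ)) =
      (v k * w k + v l * w l - v k * w l - v l * w k) / (2 * Fintype.card κ ^ 2) := by
    intro k l
    rw [div_mul_div_comm, mul_mul_mul_comm, Real.mul_self_sqrt zero_le_two]
    ring
  simp only [hterm, ← Finset.sum_div, Finset.sum_sub_distrib, Finset.sum_add_distrib,
    ← Finset.mul_sum, ← Finset.sum_mul, Finset.sum_const, Finset.card_univ, nsmul_eq_mul,
    mul_left_comm _ (Fintype.card κ : ℝ)]
  field_simp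
  ring

/-- After one query in a uniform superposition of labels, the signs `v k` on the input `x` are the
amplitudes of the state. Their mean and their scaled pairwise differences have the same Gram
matrix, so the state may equally well consist of the branches with these amplitudes. -/
theorem GramComputable.of_uniform_query {κ : Type*} [Fintype κ] [Nonempty κ]
    (L : κ → Option (Fin n)) {f g₀ : BoolFun n} {g : κ → κ → BoolFun n}
    (hg₀ : ∀ x, ∑ k, querySign x (L k) ≠ 0 → f x = g₀ x)
    (hg : ∀ k l x, queryBit x (L k) ≠ queryBit x (L l) → f x = g k l x) {t : ℕ}
    (h₀ : GramComputable g₀ t) (h : ∀ k l, GramComputable (g k l) t) :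
    GramComputable f (t + 1) := by
  let d : Option (κ × κ) → (Fin n → Bool) → ℝ
    | none, x => (∑ k, querySign x (L k)) / Fintype.card κ
    | some (k, l), x => (querySign x (L k) - querySign x (L l)) / (√2 * Fintype.card κ)
  have hd : ∀ b x, d b x ≠ 0 → f x = b.elim g₀ (fun kl => g kl.1 kl.2) x := by
    rintro (_ | ⟨k, l⟩) x hx
    · exact hg₀ x fun h0 => hx (by simp [d, h0])
    · exact hg k l x fun hkl => hx (by simp [d, querySign, hkl])
  have hsolv : ∀ b : Option (κ × κ),
      GramSolvable (b.elim g₀ (fun kl => g kl.1 kl.2)) t (of fun _ _ => 1) := by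
    rintro (_ | ⟨k, l⟩)
    exacts [h₀, h k l]
  refine ⟨fun o => ∑ k with L k = o, (Fintype.card κ : ℝ)⁻¹ • of fun _ _ => 1, fun o =>
    posSemidef_sum _ fun k _ => posSemidef_of_one.smul (by positivity), ?_, ?_⟩
  · rw [Finset.sum_fiberwise]
    ext x y
    simp [Matrix.sum_apply]
  · convert GramSolvable.sum_vecMulVec_hadamard hd hsolv using 1
    ext x y
    have hmean := sum_mul_div_card_eq_add_sum_sub_mul_sub
      (fun k => querySign x (L k)) (fun k => querySign y (L k))
    simp only [Matrix.sum_apply, hadamard_apply, vecMulVec_apply, of_apply, mul_one,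
      Matrix.smul_apply, smul_eq_mul, Finset.mul_sum, Fintype.sum_option, Fintype.sum_prod_type,
      d, ← hmean]
    rw [← Fintype.sum_option (f := fun o => ∑ k with L k = o,
      querySign x o * querySign y o * (Fintype.card κ : ℝ)⁻¹), Finset.sum_div,
      ← Finset.sum_fiberwise _ L]
    refine Finset.sum_congr rfl fun o _ => Finset.sum_congr rfl fun k hk => ?_
    rw [(Finset.mem_filter.1 hk).2, div_eq_mul_inv]

theorem GramComputable.of_xor_query (o o' : Option (Fin n)) {f : BoolFun n} {g : Bool → BoolFun n}
    (hg : ∀ x, f x = g (queryBit x o ^^ queryBit x o') x) {t : ℕ}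
    (h : ∀ b, GramComputable (g b) t) : GramComputable f (t + 1) := by
  refine of_uniform_query (cond · o o') (g₀ := g false) (g := fun _ _ => g true) ?_ ?_
    (h false) fun _ _ => h true
  · intro x hx
    have hbits : queryBit x o = queryBit x o' := by
      contrapose! hx
      rw [Fintype.sum_bool]
      cases h : queryBit x o <;> cases h' : queryBit x o' <;> simp_all [querySign]
    rw [hg, hbits, Bool.xor_self]
  · intro k l x hx
    have hbits : queryBit x o ≠ queryBit x o' := by
      cases k <;> cases l <;> simp_all [eq_comm]
    rw [hg, Bool.xor_iff_ne.2 hbits]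

theorem GramComputable.of_xor (c : Bool) (o o' : Option (Fin n)) :
    GramComputable (fun x => c ^^ (queryBit x o ^^ queryBit x o')) 1 :=
  of_xor_query o o' (g := fun b _ => c ^^ b) (fun _ => rfl) fun _ => of_const fun _ _ => rfl

/-- The restriction of `f` to the inputs whose bit `i` is `c` (if `o = none`), or differs by `c`
from another bit, which has the number `j` among the remaining bits (if `o = some j`). -/
def BoolFun.restrict (f : BoolFun (m + 1)) (i : Fin (m + 1)) (o : Option (Fin m)) (c : Bool) :
    BoolFun m :=
  fun y => f (i.insertNth (c ^^ queryBit y o) y)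

theorem queryBit_removeNth (i : Fin (m + 1)) (x : Fin (m + 1) → Bool) (o : Option (Fin m)) :
    queryBit (i.removeNth x) o = queryBit x (o.map i.succAbove) := by
  cases o <;> rfl

theorem GramComputable.of_restrict {f : BoolFun (m + 1)} (i : Fin (m + 1)) (o : Option (Fin m))
    {t : ℕ} (h : ∀ c, GramComputable (f.restrict i o c) t) : GramComputable f (t + 1) := by
  have hremove : i.removeNth = substitute (fun _ => false) fun j => some (i.succAbove j) := by
    ext x j
    simp [substitute, queryBit, Fin.removeNth]
  refine of_xor_query (some i) (o.map i.succAbove) (g := fun c => f.restrict i o c ∘ i.removeNth)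
    (fun x => ?_) fun c => hremove ▸ (h c).comp_substitute _ _
  simp only [BoolFun.restrict, Function.comp, queryBit_removeNth, Bool.xor_assoc, Bool.xor_self,
    Bool.xor_false]
  simp [queryBit]

theorem gramComputable_self : ∀ {n : ℕ} (f : BoolFun n), GramComputable f n
  | 0, f => .of_const fun x y => congrArg f (Subsingleton.elim x y)
  | _ + 1, _ => .of_restrict 0 none fun _ => gramComputable_self _

end GramMatrices

section UnitaryInvariants

open Matrix

theorem norm_linearCombination_eq_of_gram_eq {𝕜 X E F : Type*} [RCLike 𝕜]
    [SeminormedAddCommGroup E] [InnerProductSpace 𝕜 E] [SeminormedAddCommGroup F]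
    [InnerProductSpace 𝕜 F] {u : X → E} {w : X → F} (h : gram 𝕜 u = gram 𝕜 w) (c : X →₀ 𝕜) :
    ‖Finsupp.linearCombination 𝕜 u c‖ = ‖Finsupp.linearCombination 𝕜 w c‖ := by
  have hxy : ∀ x y, inner 𝕜 (u x) (u y) = inner 𝕜 (w x) (w y) := fun x y => congr_fun₂ h x y
  simp only [norm_eq_sqrt_re_inner (𝕜 := 𝕜), Finsupp.linearCombination_apply, Finsupp.sum_inner,
    Finsupp.inner_sum, inner_smul_left, inner_smul_right, hxy]

theorem exists_linearIsometry_of_gram_eq {𝕜 X E : Type*} [RCLike 𝕜] [NormedAddCommGroup E]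
    [InnerProductSpace 𝕜 E] [FiniteDimensional 𝕜 E] {u w : X → E} (h : gram 𝕜 u = gram 𝕜 w) :
    ∃ L : E →ₗᵢ[𝕜] E, ∀ x, L (u x) = w x := by
  let Lu := Finsupp.linearCombination 𝕜 u
  let Lw := Finsupp.linearCombination 𝕜 w
  have hnorm : ∀ c, ‖Lw c‖ = ‖Lu c‖ := norm_linearCombination_eq_of_gram_eq h.symm
  have hLw : ∀ c, Lw.compLeftInverse Lu ⟨Lu c, c, rfl⟩ = Lw c := fun c =>
    Lw.compLeftInverse_apply_of_bdd Lu ⟨1, fun c => (hnorm c).trans_le (one_mul _).ge⟩ c _ rfl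
  let L : LinearMap.range Lu →ₗᵢ[𝕜] E :=
    { toLinearMap := Lw.compLeftInverse Lu
      norm_map' := by
        rintro ⟨_, c, rfl⟩
        exact (congrArg norm (hLw c)).trans (hnorm c) }
  refine ⟨L.extend, fun x => ?_⟩
  simpa [Lu, Lw] using (L.extend_apply _).trans (hLw (Finsupp.single x 1))

theorem exists_mem_unitaryGroup_mulVec_eq {𝕜 X S : Type*} [RCLike 𝕜] [Fintype S] [DecidableEq S]
    {u w : X → S → 𝕜} (h : ∀ x y, star (u x) ⬝ᵥ u y = star (w x) ⬝ᵥ w y) :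
    ∃ U : unitaryGroup S 𝕜, ∀ x, (U : Matrix S S 𝕜) *ᵥ u x = w x := by
  obtain ⟨L, hL⟩ := exists_linearIsometry_of_gram_eq (𝕜 := 𝕜)
    (u := fun x => WithLp.toLp 2 (u x)) (w := fun x => WithLp.toLp 2 (w x)) <| by
      ext x y
      simpa [EuclideanSpace.inner_toLp_toLp, dotProduct_comm] using h x y
  let T : EuclideanSpace 𝕜 S →L[𝕜] EuclideanSpace 𝕜 S := L.toContinuousLinearMap
  have hT : star T * T = 1 := (ContinuousLinearMap.norm_map_iff_adjoint_comp_self T).1 L.norm_map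
  obtain ⟨U, hU⟩ := EquivLike.surjective (toEuclideanCLM (n := S) (𝕜 := 𝕜)) T
  refine ⟨⟨U, mem_unitaryGroup_iff'.2 <|
    EquivLike.injective (toEuclideanCLM (n := S) (𝕜 := 𝕜)) ?_⟩, fun x => ?_⟩
  · rw [map_mul, map_star, hU, hT, map_one]
  · rw [← (WithLp.toLp_injective 2).eq_iff, ← toEuclideanCLM_toLp, hU]
    exact hL x

theorem exists_dotProduct_eq_of_posSemidef {X : Type*} [Fintype X] {G : Matrix X X ℝ}
    (hG : G.PosSemidef) : ∃ v : X → X → ℝ, ∀ x y, v x ⬝ᵥ v y = G x y := by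
  classical
  open scoped MatrixOrder in
  obtain ⟨B, rfl⟩ := CStarAlgebra.nonneg_iff_eq_star_mul_self.1 hG.nonneg
  exact ⟨fun x z => B z x, fun x y => by simp [mul_apply, dotProduct]⟩

theorem sum_norm_sq_mulVec {𝕜 S : Type*} [RCLike 𝕜] [Fintype S] [DecidableEq S]
    (U : unitaryGroup S 𝕜) (v : S → 𝕜) :
    ∑ s, ‖((U : Matrix S S 𝕜) *ᵥ v) s‖ ^ 2 = ∑ s, ‖v s‖ ^ 2 := by
  have hdot : ∀ w : S → 𝕜, star w ⬝ᵥ w = ((∑ s, ‖w s‖ ^ 2 : ℝ) : 𝕜) := fun w => by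
    simp [dotProduct, RCLike.conj_mul]
  have hU : (U : Matrix S S 𝕜)ᴴ * U = 1 := mem_unitaryGroup_iff'.1 U.2
  apply RCLike.ofReal_injective (K := 𝕜)
  rw [← hdot, ← hdot, star_mulVec, dotProduct_mulVec, vecMul_vecMul, hU, vecMul_one]

end UnitaryInvariants

namespace QueryAlgorithm

variable {n : ℕ} (A : QueryAlgorithm n)

theorem phase_eq_querySign (x : Fin n → Bool) (s : A.State) :
    A.phase x s = (querySign x (A.bit s) : ℂ) := by
  unfold phase
  cases A.bit s with
  | none => simp [querySign, queryBit]
  | some i => cases h : x i <;> simp [querySign, queryBit, h]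

theorem norm_phase (x : Fin n → Bool) (s : A.State) : ‖A.phase x s‖ = 1 := by
  unfold phase
  split
  · exact norm_one
  · split_ifs <;> simp

theorem sum_norm_sq_stateAfter (x : Fin n → Bool) (k : ℕ) :
    ∑ s, ‖A.stateAfter x k s‖ ^ 2 = 1 := by
  induction k with
  | zero => rw [stateAfter, sum_norm_sq_mulVec, A.start_norm]
  | succ k ih => simp_rw [stateAfter, sum_norm_sq_mulVec, query, norm_mul, norm_phase, one_mul, ih]

theorem outputProb_eq_one_iff (x : Fin n → Bool) (b : Bool) :
    A.outputProb x b = 1 ↔ ∀ s, A.output s ≠ b → A.stateAfter x A.queries s = 0 := by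
  have hsplit : A.outputProb x b + ∑ s with A.output s ≠ b, ‖A.stateAfter x A.queries s‖ ^ 2 = 1 :=
    (Finset.sum_filter_add_sum_filter_not ..).trans (A.sum_norm_sq_stateAfter x _)
  rw [← hsplit, left_eq_add]
  simp [Finset.sum_eq_zero_iff_of_nonneg]

end QueryAlgorithm

section GramAlgorithm

open Matrix

variable {n : ℕ}

/-- The basis states of the algorithm that is built from a solution in Gram matrices: a query
label, a register for the output, and a work register. -/
abbrev GramState (n : ℕ) : Type := Option (Fin n) × Bool × (Fin n → Bool)

theorem exists_gramState_of_orthogonal {f : BoolFun n} {G : InputMatrix n} (hG : G.PosSemidef)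
    (horth : ∀ x y, f x ≠ f y → G x y = 0) :
    ∃ φ : (Fin n → Bool) → GramState n → ℝ,
      (∀ x y, φ x ⬝ᵥ φ y = G x y) ∧ ∀ x s, s.2.1 ≠ f x → φ x s = 0 := by
  obtain ⟨v, hv⟩ := exists_dotProduct_eq_of_posSemidef hG
  refine ⟨fun x s => if s.1 = none ∧ s.2.1 = f x then v x s.2.2 else 0, fun x y => ?_,
    fun x s hs => if_neg fun h => hs h.2⟩
  by_cases hxy : f x = f y
  · simp [dotProduct, Fintype.sum_prod_type, ite_and, hxy, ← hv]
  · simp [dotProduct, Fintype.sum_prod_type, ite_and, horth x y hxy, Ne.symm hxy]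

theorem GramSolvable.exists_gramState {f : BoolFun n} {t : ℕ} {G : InputMatrix n}
    (h : GramSolvable f t G) (hG : G.PosSemidef) :
    ∃ ψ : ℕ → (Fin n → Bool) → GramState n → ℝ,
      (∀ x y, ψ 0 x ⬝ᵥ ψ 0 y = G x y) ∧
      (∀ k < t, ∀ x y, ψ (k + 1) x ⬝ᵥ ψ (k + 1) y =
        (fun s => querySign x s.1 * ψ k x s) ⬝ᵥ fun s => querySign y s.1 * ψ k y s) ∧
      ∀ x s, s.2.1 ≠ f x → ψ t x s = 0 := by
  induction t generalizing G with
  | zero =>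
    obtain ⟨φ, hφ, hsupp⟩ := exists_gramState_of_orthogonal hG h
    exact ⟨fun _ => φ, hφ, fun k hk => absurd hk k.not_lt_zero, hsupp⟩
  | succ t ih =>
    obtain ⟨M, hM, hsum, hsolv⟩ := h
    choose v hv using fun o => exists_dotProduct_eq_of_posSemidef (hM o)
    obtain ⟨ψ, h0, hstep, hend⟩ := ih hsolv <|
      posSemidef_sum _ fun o _ => posSemidef_vecMulVec_hadamard (hM o) _
    let φ : (Fin n → Bool) → GramState n → ℝ := fun x s => if s.2.1 then 0 else v s.1 x s.2.2
    have hφ : ∀ x y (d : Option (Fin n) → ℝ), ∑ s, d s.1 * (φ x s * φ y s) =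
        ∑ o, d o * M o x y := fun x y d => by
      simp only [φ, Fintype.sum_prod_type, ← hv, dotProduct, Fintype.sum_bool, Finset.mul_sum]
      simp
    have hφG : ∀ x y, φ x ⬝ᵥ φ y = G x y := fun x y => by
      simpa only [dotProduct, one_mul, ← hsum, Matrix.sum_apply] using hφ x y fun _ => 1
    have hφψ : ∀ x y, ψ 0 x ⬝ᵥ ψ 0 y =
        (fun s => querySign x s.1 * φ x s) ⬝ᵥ fun s => querySign y s.1 * φ y s := fun x y => by
      simp only [h0, Matrix.sum_apply, hadamard_apply, vecMulVec_apply]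
      rw [← hφ x y fun o => querySign x o * querySign y o]
      exact Finset.sum_congr rfl fun s _ => mul_mul_mul_comm ..
    refine ⟨fun k => k.casesOn φ ψ, hφG, fun k hk => ?_, hend⟩
    cases k with
    | zero => exact hφψ
    | succ k => exact hstep k (by lia)

/-- The algorithm with `t` queries and unitaries `U` on the basis states `GramState n`. -/
abbrev gramAlgorithm (t : ℕ) (U : ℕ → unitaryGroup (GramState n) ℂ) : QueryAlgorithm n where
  State := GramState n
  bit := Prod.fst
  start := Pi.single (none, false, fun _ => false) 1
  start_norm := by simp [Pi.single_apply, apply_ite]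
  queries := t
  U := U
  output s := s.2.1

theorem exists_stateAfter_gramAlgorithm_eq {t : ℕ} {ψ : ℕ → (Fin n → Bool) → GramState n → ℝ}
    (h0 : ∀ x y, ψ 0 x ⬝ᵥ ψ 0 y = 1)
    (hstep : ∀ k < t, ∀ x y, ψ (k + 1) x ⬝ᵥ ψ (k + 1) y =
      (fun s => querySign x s.1 * ψ k x s) ⬝ᵥ fun s => querySign y s.1 * ψ k y s) :
    ∃ U, ∀ x, ∀ k ≤ t, (gramAlgorithm t U).stateAfter x k = fun s => (ψ k x s : ℂ) := by
  have hreal : ∀ v w : GramState n → ℝ,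
      star (fun s => (v s : ℂ)) ⬝ᵥ (fun s => (w s : ℂ)) = ((v ⬝ᵥ w : ℝ) : ℂ) := fun v w => by
    simp [dotProduct]
  obtain ⟨U₀, hU₀⟩ := exists_mem_unitaryGroup_mulVec_eq
    (u := fun _ : Fin n → Bool => (Pi.single (none, false, fun _ => false) 1 : GramState n → ℂ))
    (w := fun x s => (ψ 0 x s : ℂ)) fun x y => by simp [hreal, h0]
  have hU : ∀ k < t, ∃ U : unitaryGroup (GramState n) ℂ, ∀ x,
      (U : Matrix (GramState n) (GramState n) ℂ) *ᵥ
        (fun s => ((querySign x s.1 * ψ k x s : ℝ) : ℂ)) = fun s => (ψ (k + 1) x s : ℂ) :=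
    fun k hk => exists_mem_unitaryGroup_mulVec_eq fun x y => by rw [hreal, hreal, hstep k hk]
  choose! U hU using hU
  refine ⟨fun k => k.casesOn U₀ U, fun x k => ?_⟩
  induction k with
  | zero => exact fun _ => hU₀ x
  | succ k ih =>
    intro hk
    rw [← hU k hk x, QueryAlgorithm.stateAfter, ih (by lia)]
    congr 1
    ext s
    rw [QueryAlgorithm.query, QueryAlgorithm.phase_eq_querySign, Complex.ofReal_mul]

theorem GramComputable.exactQuantumQueryComplexity_le {f : BoolFun n} {t : ℕ}
    (h : GramComputable f t) : exactQuantumQueryComplexity f ≤ t := by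
  obtain ⟨ψ, h0, hstep, hend⟩ := h.exists_gramState posSemidef_of_one
  obtain ⟨U, hU⟩ := exists_stateAfter_gramAlgorithm_eq h0 hstep
  refine iInf₂_le (gramAlgorithm t U) fun x =>
    (QueryAlgorithm.outputProb_eq_one_iff _ x (f x)).2 fun s hs => ?_
  rw [hU x t le_rfl]
  exact congrArg Complex.ofReal (hend x s hs)

end GramAlgorithm

section LowerBound

open scoped Finset symmDiff

variable {n : ℕ}

/-- The Walsh character of the set `S` of input bits. -/
noncomputable def walsh (S : Finset (Fin n)) (x : Fin n → Bool) : ℝ :=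
  ∏ i ∈ S, querySign x (some i)

theorem walsh_ne_zero (S : Finset (Fin n)) (x : Fin n → Bool) : walsh S x ≠ 0 :=
  Finset.prod_ne_zero_iff.2 fun i _ => left_ne_zero_of_mul_eq_one (querySign_mul_self x (some i))

theorem walsh_eq_prod_univ (S : Finset (Fin n)) (x : Fin n → Bool) :
    walsh S x = ∏ i, if i ∈ S then querySign x (some i) else 1 := by
  rw [Finset.prod_ite_mem, Finset.univ_inter, walsh]

theorem sum_walsh {S : Finset (Fin n)} (hS : S.Nonempty) : ∑ x, walsh S x = 0 := by
  obtain ⟨i, hi⟩ := hS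
  calc ∑ x, walsh S x
      = ∑ x : Fin n → Bool, ∏ i, if i ∈ S then (if x i then -1 else 1 : ℝ) else 1 :=
        Finset.sum_congr rfl fun x _ => walsh_eq_prod_univ S x
    _ = ∏ i, ∑ b : Bool, if i ∈ S then (if b then -1 else 1 : ℝ) else 1 :=
        (Fintype.prod_sum fun i (b : Bool) => if i ∈ S then (if b then -1 else 1 : ℝ) else 1).symm
    _ = 0 := Finset.prod_eq_zero (Finset.mem_univ i) (by simp [hi])

theorem walsh_mul_walsh (S T : Finset (Fin n)) (x : Fin n → Bool) :
    walsh S x * walsh T x = walsh (S ∆ T) x := by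
  simp only [walsh_eq_prod_univ, ← Finset.prod_mul_distrib]
  refine Finset.prod_congr rfl fun i _ => ?_
  by_cases hS : i ∈ S <;> by_cases hT : i ∈ T <;>
    simp [hS, hT, Finset.mem_symmDiff, querySign_mul_self]

theorem querySign_eq_walsh (x : Fin n → Bool) (o : Option (Fin n)) :
    querySign x o = walsh o.toFinset x := by
  cases o <;> simp [walsh, querySign, queryBit]

theorem card_le_card_symmDiff_toFinset_add_one (S : Finset (Fin n)) (o : Option (Fin n)) :
    #S ≤ #(S ∆ o.toFinset) + 1 :=
  calc #S ≤ #(S ∆ o.toFinset ∪ o.toFinset) := Finset.card_le_card fun i hi => by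
        by_cases h : i ∈ o.toFinset <;> simp [Finset.mem_symmDiff, hi, h]
    _ ≤ #(S ∆ o.toFinset) + #o.toFinset := Finset.card_union_le _ _
    _ ≤ #(S ∆ o.toFinset) + 1 := by gcongr; cases o <;> simp

/-- After `k` queries the amplitudes are polynomials of degree at most `k` in the input signs. -/
theorem QueryAlgorithm.sum_walsh_smul_stateAfter (A : QueryAlgorithm n) {k : ℕ}
    {S : Finset (Fin n)} (hS : k < #S) : ∑ x, walsh S x • A.stateAfter x k = 0 := by
  induction k generalizing S with
  | zero => simp only [stateAfter, ← Finset.sum_smul, sum_walsh (Finset.card_pos.1 hS), zero_smul]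
  | succ k ih =>
    have hquery : ∑ x, walsh S x • A.query x (A.stateAfter x k) = 0 := by
      ext s
      have hcard : k < #(S ∆ (A.bit s).toFinset) := by
        have := card_le_card_symmDiff_toFinset_add_one S (A.bit s)
        lia
      have hs := congrFun (ih hcard) s
      simp only [Finset.sum_apply, Pi.smul_apply, ← walsh_mul_walsh, ← querySign_eq_walsh] at hs ⊢
      simpa only [query, A.phase_eq_querySign, Complex.real_smul, Complex.ofReal_mul,
        mul_assoc] using hs
    simp only [stateAfter, ← Matrix.mulVec_smul, ← Matrix.mulVec_sum, hquery, Matrix.mulVec_zero]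

/-- `f` is of AND type if it takes one of its values exactly once. -/
def IsAndType (f : BoolFun n) : Prop := ∃ v, ∃! x, f x = v

/-- The sole input `p` with its value would be reached with amplitude `0`: all other inputs have
amplitude `0` on the basis states with this output, and a combination of all amplitudes in which
that of `p` has a nonzero coefficient vanishes. -/
theorem IsAndType.le_queries {f : BoolFun n} (hf : IsAndType f) {A : QueryAlgorithm n}
    (hA : A.ComputesExactly f) : n ≤ A.queries := by
  obtain ⟨_, p, rfl, hp⟩ := hf
  by_contra! hlt
  have hothers : ∀ x s, x ≠ p → A.output s = f p → A.stateAfter x A.queries s = 0 :=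
    fun x s hx hs => (A.outputProb_eq_one_iff x _).1 (hA x) s fun h => hx (hp x (h.symm.trans hs))
  have hzero : ∀ s, A.output s = f p → A.stateAfter p A.queries s = 0 := fun s hs => by
    have hsum := congrFun (A.sum_walsh_smul_stateAfter (S := Finset.univ) (by simpa using hlt)) s
    simp only [Finset.sum_apply, Pi.smul_apply, Pi.zero_apply] at hsum
    rw [Finset.sum_eq_single p (fun x _ hx => by rw [hothers x s hx hs, smul_zero]) (by simp)]
      at hsum
    exact (smul_eq_zero.1 hsum).resolve_left (walsh_ne_zero _ _)
  have hprob : A.outputProb p (f p) = 0 := Finset.sum_eq_zero fun s hs => by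
    rw [hzero s (Finset.mem_filter.1 hs).2, norm_zero, sq, zero_mul]
  exact zero_ne_one (hprob.symm.trans (hA p))

theorem IsAndType.le_exactQuantumQueryComplexity {f : BoolFun n} (hf : IsAndType f) :
    n ≤ exactQuantumQueryComplexity f :=
  le_iInf₂ fun _ hA => Nat.cast_le.2 (hf.le_queries hA)

end LowerBound

section AndType

variable {n : ℕ}

theorem andFun_xor_comp_perm (σ : Equiv.Perm (Fin n)) (a x : Fin n → Bool) :
    andFun n (fun i => a i ^^ x (σ i)) = decide (x = fun i => !a (σ.symm i)) := by
  rw [andFun, decide_eq_decide, funext_iff,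
    ← σ.forall_congr_right (q := fun i => x i = !a (σ.symm i))]
  refine forall_congr' fun i => ?_
  rw [σ.symm_apply_apply]
  cases a i <;> simp

theorem queryIsomorphic_andFun_iff {f : BoolFun n} :
    QueryIsomorphic f (andFun n) ↔ IsAndType f := by
  constructor
  · rintro ⟨σ, a, c, h⟩
    simp only [andFun_xor_comp_perm] at h
    refine ⟨!c, fun i => !a (σ.symm i), by simp [h], fun x hx => ?_⟩
    by_contra hne
    simp [h, hne] at hx
  · rintro ⟨v, p, rfl, huniq⟩
    refine ⟨Equiv.refl _, fun i => !p i, !f p, fun x => ?_⟩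
    rw [andFun_xor_comp_perm]
    by_cases hx : x = p
    · simp [hx]
    · simpa [hx] using Bool.eq_not_of_ne (mt (huniq x) hx)

end AndType

section Restrictions

open scoped Finset

variable {m : ℕ}

theorem BoolFun.card_restrict (f : BoolFun (m + 1)) (i : Fin (m + 1)) (o : Option (Fin m))
    (c v : Bool) :
    #{y | f.restrict i o c y = v} =
      #{x | f x = v ∧ (x i ^^ queryBit x (o.map i.succAbove)) = c} := by
  have hinsert : ∀ x, (x i ^^ queryBit x (o.map i.succAbove)) = c →
      i.insertNth (c ^^ queryBit (i.removeNth x) o) (i.removeNth x) = x := by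
    rintro x rfl
    rw [queryBit_removeNth, Bool.xor_assoc, Bool.xor_self, Bool.xor_false,
      Fin.insertNth_self_removeNth]
  refine Finset.card_nbij' (fun y => i.insertNth (c ^^ queryBit y o) y) i.removeNth ?_ ?_ ?_ ?_
  · intro y hy
    rw [Finset.mem_coe, Finset.mem_filter] at hy ⊢
    simpa [← queryBit_removeNth, BoolFun.restrict] using hy
  · intro x hx
    simp only [Finset.coe_filter, Finset.mem_univ, true_and, Set.mem_ofPred_eq] at hx ⊢
    rw [BoolFun.restrict, hinsert x hx.2, hx.1]
  · intro y _
    simp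
  · intro x hx
    simp only [Finset.coe_filter, Finset.mem_univ, true_and, Set.mem_ofPred_eq] at hx
    exact hinsert x hx.2

theorem BoolFun.card_restrict_false_add_card_restrict_true (f : BoolFun (m + 1)) (i : Fin (m + 1))
    (o : Option (Fin m)) (v : Bool) :
    #{y | f.restrict i o false y = v} + #{y | f.restrict i o true y = v} = #{x | f x = v} := by
  simp only [card_restrict, ← Bool.not_eq_false, ← Finset.filter_filter]
  exact Finset.card_filter_add_card_filter_not _

theorem card_filter_add_card_filter_add_card_filter_xor {X : Type*} (s : Finset X)
    (u w : X → Bool) (b b' : Bool) :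
    #{x ∈ s | u x = b} + #{x ∈ s | w x = b'} + #{x ∈ s | (u x ^^ w x) = (b ^^ b')} =
      #s + 2 * #{x ∈ s | u x = b ∧ w x = b'} := by
  simp only [Finset.card_filter, Finset.card_eq_sum_ones s, Finset.mul_sum,
    ← Finset.sum_add_distrib]
  refine Finset.sum_congr rfl fun x _ => ?_
  cases b <;> cases b' <;> cases u x <;> cases w x <;> rfl

theorem exists_restrict_even {f : BoolFun (m + 2)} (hf : Even #{x | f x}) :
    ∃ i o, ∀ c, Even #{y | f.restrict i o c y} := by
  obtain ⟨i, o, h⟩ : ∃ i o, Even #{y | f.restrict i o false y} := by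
    by_contra! hodd
    have hcount := card_filter_add_card_filter_add_card_filter_xor {x | f x} (· 0) (· 1)
      false false
    have h₀ := hodd 0 none
    have h₁ := hodd 1 none
    have h₀₁ := hodd 0 (some 0)
    simp only [BoolFun.card_restrict, queryBit, Option.map, Option.elim, Bool.xor_false,
      Fin.zero_succAbove, Fin.succ_zero_eq_one] at h₀ h₁ h₀₁
    simp only [Finset.filter_filter, Bool.xor_false] at hcount
    grind
  have hsum := f.card_restrict_false_add_card_restrict_true i o true
  rw [← hsum, Nat.even_add] at hf
  exact ⟨i, o, fun | false => h | true => hf.1 h⟩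

theorem GramComputable.of_even :
    ∀ {m : ℕ} {f : BoolFun (m + 1)}, Even #{x | f x} → GramComputable f m
  | 0, f, h => .of_const (by revert f; decide)
  | _ + 1, _, h => by
    obtain ⟨i, o, hc⟩ := exists_restrict_even h
    exact .of_restrict i o fun c => .of_even (hc c)

theorem isAndType_of_not_even_of_le_two {n : ℕ} {f : BoolFun n} (hf : ¬Even #{x | f x})
    (hn : n ≤ 2) : IsAndType f := by
  simp only [IsAndType, Fintype.existsUnique_iff_card_one]
  interval_cases n <;> revert f <;> decide

end Restrictions

section ThreeBits

open scoped Finset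

/-- The linear form `l · y` in three bits. -/
def linearForm₃ (l y : Fin 3 → Bool) : Bool := (l 0 && y 0) ^^ (l 1 && y 1) ^^ (l 2 && y 2)

/-- The quadratic form with the coefficient `q i` at the product of the two bits other than `i`. -/
def quadraticForm₃ (q y : Fin 3 → Bool) : Bool :=
  (q 0 && y 1 && y 2) ^^ (q 1 && y 0 && y 2) ^^ (q 2 && y 0 && y 1)

theorem exists_algebraicNormalForm₃ (f : BoolFun 3) :
    ∃ d q l k, ∀ x, f x =
      ((d && x 0 && x 1 && x 2) ^^ quadraticForm₃ q x ^^ linearForm₃ l x ^^ k) := by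
  obtain ⟨F, hF⟩ : ∃ F : Bool → Bool → Bool → Bool, ∀ x, f x = F (x 0) (x 1) (x 2) :=
    ⟨fun a b c => f ![a, b, c], fun x => congrArg f (by ext i; fin_cases i <;> rfl)⟩
  have hbit : ∀ G : Bool → Bool, ∃ u v, ∀ b, G b = (u ^^ (b && v)) := by decide
  choose u v hF' using fun a b => hbit (F a b)
  choose u₀ u₁ hu using fun a => hbit (u a)
  choose v₀ v₁ hv using fun a => hbit (v a)
  obtain ⟨k, l₀, hu₀⟩ := hbit u₀
  obtain ⟨l₁, q₂, hu₁⟩ := hbit u₁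
  obtain ⟨l₂, q₁, hv₀⟩ := hbit v₀
  obtain ⟨q₀, d, hv₁⟩ := hbit v₁
  refine ⟨d, ![q₀, q₁, q₂], ![l₀, l₁, l₂], k, fun x => ?_⟩
  simp only [hF, hF', hu, hv, hu₀, hu₁, hv₀, hv₁, quadraticForm₃, linearForm₃, Matrix.cons_val]
  cases x 0 <;> cases x 1 <;> cases x 2 <;>
    simp only [Bool.true_and, Bool.false_and, Bool.and_true, Bool.and_false, Bool.xor_false,
      Bool.xor_comm, Bool.xor_left_comm]

theorem even_card_quadratic₃ :
    ∀ q l k, Even #{x | (quadraticForm₃ q x ^^ linearForm₃ l x ^^ k) = true} := by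
  decide +kernel

/-- The exclusive or of the indicator function of `000` and an affine function. -/
def zeroXorAffine₃ (l : Fin 3 → Bool) (k : Bool) : BoolFun 3 :=
  fun y => decide (∀ i, y i = false) ^^ linearForm₃ l y ^^ k

theorem and_xor_quadraticForm₃ :
    ∀ q x : Fin 3 → Bool, ((x 0 && x 1 && x 2) ^^ quadraticForm₃ q x) =
      (((x 0 ^^ q 0) && (x 1 ^^ q 1) && (x 2 ^^ q 2)) ^^
        linearForm₃ ![q 1 && q 2, q 0 && q 2, q 0 && q 1] x ^^ (q 0 && q 1 && q 2)) := by
  decide +kernel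

theorem linearForm₃_xor_left :
    ∀ l l' x, linearForm₃ (fun i => l i ^^ l' i) x = (linearForm₃ l x ^^ linearForm₃ l' x) := by
  decide +kernel

theorem linearForm₃_xor_right :
    ∀ l x y, linearForm₃ l (fun i => x i ^^ y i) = (linearForm₃ l x ^^ linearForm₃ l y) := by
  decide +kernel

theorem exists_eq_zeroXorAffine₃_comp_substitute {f : BoolFun 3} (hf : ¬Even #{x | f x}) :
    ∃ a l k, f = zeroXorAffine₃ l k ∘ substitute a some := by
  obtain ⟨d, q, l, k, hdqlk⟩ := exists_algebraicNormalForm₃ f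
  cases d with
  | false => exact absurd (by simpa [hdqlk] using even_card_quadratic₃ q l k) hf
  | true =>
    let a : Fin 3 → Bool := fun i => !q i
    obtain ⟨l', hl'⟩ : ∃ l', ∀ x, linearForm₃ l' x =
        (linearForm₃ ![q 1 && q 2, q 0 && q 2, q 0 && q 1] x ^^ linearForm₃ l x) :=
      ⟨_, linearForm₃_xor_left _ l⟩
    refine ⟨a, l', (q 0 && q 1 && q 2) ^^ k ^^ linearForm₃ l' a, funext fun x => ?_⟩
    have hzero : decide (∀ i, substitute a some x i = false) =
        ((x 0 ^^ q 0) && (x 1 ^^ q 1) && (x 2 ^^ q 2)) := by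
      have hbit : ∀ i, substitute a some x i = false ↔ (x i ^^ q i) = true := fun i => by
        change (!q i ^^ x i) = false ↔ _
        cases q i <;> cases x i <;> decide
      simp only [hbit, Fin.forall_fin_succ, Fin.forall_fin_zero, and_true, Bool.decide_and,
        Bool.decide_eq_true, Bool.and_assoc]
      rfl
    have hlinear : linearForm₃ l' (substitute a some x) =
        (linearForm₃ l' a ^^ linearForm₃ l' x) := linearForm₃_xor_right l' a x
    have hcancel : ∀ u v w c k b,
        (u ^^ v ^^ c ^^ w ^^ k) = (u ^^ (b ^^ (v ^^ w)) ^^ (c ^^ k ^^ b)) := by decide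
    rw [hdqlk, Bool.true_and, and_xor_quadraticForm₃, Function.comp, zeroXorAffine₃, hzero, hlinear,
      hl' x]
    exact hcancel ..

theorem exists_linearForm₃_eq_xor :
    ∀ l, (∃ i, l i = false) →
      ∃ o o', ∀ y, linearForm₃ l y = (queryBit y o ^^ queryBit y o') := by
  decide +kernel

/-- If all coefficients are `true`, then the form is the exclusive or of the bits at all four
labels, including the zero bit at `none`, and the bits at `o` and `o'` contribute `true`. -/
theorem exists_linearForm₃_eq_xor_of_ne :
    ∀ l o o', ∃ c p q, ∀ y, queryBit y o ≠ queryBit y o' →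
      linearForm₃ l y = (c ^^ (queryBit y p ^^ queryBit y q)) := by
  decide +kernel

theorem gramComputable_zeroXorAffine₃ {l : Fin 3 → Bool} (hl : ∃ i, l i = true) (k : Bool) :
    GramComputable (zeroXorAffine₃ l k) 2 := by
  obtain ⟨o, o', ho⟩ := exists_linearForm₃_eq_xor (fun i => !l i) (by simpa using hl)
  choose c p q hpq using exists_linearForm₃_eq_xor_of_ne l
  refine .of_uniform_query id (g₀ := fun y => (!k) ^^ (queryBit y o ^^ queryBit y o'))
    (g := fun r r' y => (k ^^ c r r') ^^ (queryBit y (p r r') ^^ queryBit y (q r r'))) ?_ ?_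
    (.of_xor _ _ _) fun _ _ => .of_xor _ _ _
  · intro y hy
    have hzero : decide (∀ i, y i = false) = !(y 0 ^^ y 1 ^^ y 2) := by
      simp only [Fintype.sum_option, Fin.sum_univ_three, querySign, queryBit, Option.elim, id] at hy
      rw [Bool.eq_iff_iff, decide_eq_true_iff, Fin.forall_fin_succ, Fin.forall_fin_two]
      cases h₀ : y 0 <;> cases h₁ : y 1 <;> cases h₂ : y 2 <;> simp_all
    have hl : linearForm₃ l y = (y 0 ^^ y 1 ^^ y 2 ^^ linearForm₃ (fun i => !l i) y) := by
      unfold linearForm₃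
      grind
    rw [zeroXorAffine₃, hl, hzero, ← ho]
    grind
  · intro r r' y hy
    have hzero : decide (∀ i, y i = false) = false := by
      contrapose! hy
      have hy' : ∀ o, queryBit y o = false := by
        rintro (_ | i) <;> simp_all [queryBit]
      exact (hy' _).trans (hy' _).symm
    rw [zeroXorAffine₃, hzero, hpq r r' y hy, Bool.false_xor, Bool.xor_comm, Bool.xor_assoc]

theorem gramComputable_of_not_even₃ {f : BoolFun 3} (hodd : ¬Even #{x | f x})
    (hf : ¬IsAndType f) : GramComputable f 2 := by
  obtain ⟨a, l, k, rfl⟩ := exists_eq_zeroXorAffine₃_comp_substitute hodd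
  refine (gramComputable_zeroXorAffine₃ ?_ k).comp_substitute a some
  contrapose! hf
  simp only [Bool.not_eq_true] at hf
  have hvalue : ∀ x, (zeroXorAffine₃ l k ∘ substitute a some) x = (decide (a = x) ^^ k) := by
    simp [zeroXorAffine₃, linearForm₃, hf, substitute, queryBit, funext_iff]
  have hiff : ∀ x, (zeroXorAffine₃ l k ∘ substitute a some) x = (!k) ↔ x = a := fun x => by
    rw [hvalue]
    by_cases hx : a = x <;> simp [hx, eq_comm]
  exact ⟨!k, a, (hiff a).2 rfl, fun x => (hiff x).1⟩

end ThreeBits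

section FourBits

open scoped Finset

variable {m n : ℕ}

theorem isAndType_restrict_iff {f : BoolFun (m + 1)} {i : Fin (m + 1)} {o : Option (Fin m)}
    {c : Bool} : IsAndType (f.restrict i o c) ↔
      ∃ v, ∃! x, f x = v ∧ (x i ^^ queryBit x (o.map i.succAbove)) = c := by
  simp only [IsAndType, Fintype.existsUnique_iff_card_one, BoolFun.card_restrict]

theorem eq_of_existsUnique_and_eq {X : Type*} {f : X → Bool} {P Q : X → Prop} {v w : Bool}
    (hv : ∃! x, f x = v ∧ P x) (hw : ∃! x, f x = w ∧ Q x)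
    (hPQ : ∀ p q, ∃ x, P x ∧ Q x ∧ x ≠ p ∧ x ≠ q) : v = w := by
  obtain ⟨p, -, hp⟩ := hv
  obtain ⟨q, -, hq⟩ := hw
  obtain ⟨x, hPx, hQx, hxp, hxq⟩ := hPQ p q
  have hxv : f x ≠ v := fun h => hxp (hp x ⟨h, hPx⟩)
  have hxw : f x ≠ w := fun h => hxq (hq x ⟨h, hQx⟩)
  exact (Bool.eq_not_of_ne hxv.symm).trans (Bool.eq_not_of_ne hxw.symm).symm

theorem exists_apply_eq_and_apply_eq_and_ne (hn : 4 ≤ n) {i j : Fin n} (hij : i ≠ j) (b b' : Bool)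
    (p q : Fin n → Bool) : ∃ x : Fin n → Bool, x i = b ∧ x j = b' ∧ x ≠ p ∧ x ≠ q := by
  have hcard : 1 < #({i, j}ᶜ : Finset (Fin n)) := by
    rw [Finset.card_compl, Finset.card_pair hij, Fintype.card_fin]
    lia
  obtain ⟨k, hk, l, hl, hkl⟩ := Finset.one_lt_card.1 hcard
  simp only [Finset.mem_compl, Finset.mem_insert, Finset.mem_singleton, not_or] at hk hl
  refine ⟨fun t => if t = i then b else if t = j then b' else if t = k then !p k else !q l,
    by simp, by simp [hij.symm], fun h => ?_, fun h => ?_⟩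
  · simpa [hk] using congrFun h k
  · simpa [hl, hkl.symm] using congrFun h l

/-- Two of the halves of the cube in question meet in at least four inputs. If different values
were each taken once on one of them, then these two inputs would be the only ones in common. -/
theorem exists_common_value (hm : 3 ≤ m) {f : BoolFun (m + 1)}
    (hf : ∀ i o, ∃ c, IsAndType (f.restrict i o c)) :
    ∃ v, (∀ i, ∃ b, ∃! x, f x = v ∧ x i = b) ∧
      ∀ i j, i ≠ j → ∃ c, ∃! x, f x = v ∧ (x i ^^ x j) = c := by
  simp only [isAndType_restrict_iff] at hf
  have hbit : ∀ i, ∃ b v, ∃! x, f x = v ∧ x i = b := fun i => by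
    simpa [queryBit] using hf i none
  have hxor : ∀ i j, i ≠ j → ∃ c v, ∃! x, f x = v ∧ (x i ^^ x j) = c := fun i j hij => by
    obtain ⟨k, rfl⟩ := Fin.exists_succAbove_eq hij.symm
    exact hf i (some k)
  choose b v hv using hbit
  have hconst : ∀ i j, v i = v j := fun i j => by
    by_cases hij : i = j
    · rw [hij]
    · exact eq_of_existsUnique_and_eq (hv i) (hv j)
        (exists_apply_eq_and_apply_eq_and_ne (by lia) hij (b i) (b j))
  refine ⟨v 0, fun i => ⟨b i, hconst i 0 ▸ hv i⟩, fun i j hij => ?_⟩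
  obtain ⟨c, w, hw⟩ := hxor i j hij
  have hwv : w = v i := eq_of_existsUnique_and_eq hw (hv i) fun p q => by
    obtain ⟨x, hi, hj, hx⟩ :=
      exists_apply_eq_and_apply_eq_and_ne (by lia) hij (b i) (b i ^^ c) p q
    exact ⟨x, by rw [hi, hj, ← Bool.xor_assoc, Bool.xor_self, Bool.false_xor], hi, hx⟩
  exact ⟨c, hconst i 0 ▸ hwv ▸ hw⟩

theorem card_add_two_mul_card_eq_three {X : Type*} {s : Finset X} {u w : X → Bool} {b b' c : Bool}
    (hu : #{x ∈ s | u x = b} = 1) (hw : #{x ∈ s | w x = b'} = 1)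
    (huw : #{x ∈ s | (u x ^^ w x) = c} = 1) : #s + 2 * #{x ∈ s | u x = b ∧ w x = b'} = 3 := by
  have hcount := card_filter_add_card_filter_add_card_filter_xor s u w b b'
  by_cases hc : c = (b ^^ b')
  · subst hc
    lia
  · have hcompl := Finset.card_filter_add_card_filter_not (s := s) fun x => (u x ^^ w x) = (b ^^ b')
    simp only [← Bool.eq_not, ← Bool.eq_not_of_ne hc] at hcompl
    lia

theorem exists_restrict_not_isAndType (hm : 3 ≤ m) {f : BoolFun (m + 1)} (hf : ¬IsAndType f) :
    ∃ i o, ∀ c, ¬IsAndType (f.restrict i o c) := by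
  by_contra! hrestrict
  obtain ⟨v, hbit, hxor⟩ := exists_common_value hm hrestrict
  choose b s hs using hbit
  have hvalue : ∀ i, f (s i) = v := fun i => (hs i).1.1
  have hcount : ∀ i j, i ≠ j →
      #{x | f x = v} + 2 * #{x ∈ {x | f x = v} | x i = b i ∧ x j = b j} = 3 := fun i j hij => by
    obtain ⟨c, hc⟩ := hxor i j hij
    refine card_add_two_mul_card_eq_three (c := c) ?_ ?_ ?_ <;>
      rw [Finset.filter_filter, ← Fintype.existsUnique_iff_card_one]
    exacts [⟨s i, hs i⟩, ⟨s j, hs j⟩, hc]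
  have hinj : Function.Injective s := fun i j hij => by
    by_contra hne
    have hcommon : 0 < #{x ∈ {x | f x = v} | x i = b i ∧ x j = b j} :=
      Finset.card_pos.2 ⟨s i, by simp [hvalue, (hs i).1.2, hij ▸ (hs j).1.2]⟩
    have hone : #{x | f x = v} = 1 := by
      have := hcount i j hne
      lia
    exact hf ⟨v, (Fintype.existsUnique_iff_card_one _).2 hone⟩
  have hcard : m + 1 ≤ #{x | f x = v} :=
    calc m + 1 = #(Finset.univ.image s) := by
          rw [Finset.card_image_of_injective _ hinj, Finset.card_univ, Fintype.card_fin]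
      _ ≤ #{x | f x = v} := Finset.card_le_card fun x hx => by
          obtain ⟨i, -, rfl⟩ := Finset.mem_image.1 hx
          simp [hvalue]
  have hle := hcount 0 (Fin.last m) (by simp [Fin.ext_iff]; lia)
  lia

theorem gramComputable_of_not_isAndType :
    ∀ {m : ℕ} {f : BoolFun (m + 1)}, ¬IsAndType f → GramComputable f m
  | 0, f, hf => by
    by_contra h
    exact hf (isAndType_of_not_even_of_le_two (mt .of_even h) one_le_two)
  | 1, f, hf => by
    by_contra h
    exact hf (isAndType_of_not_even_of_le_two (mt .of_even h) le_rfl)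
  | 2, f, hf => by
    by_contra h
    exact h (gramComputable_of_not_even₃ (mt .of_even h) hf)
  | m + 3, f, hf => by
    obtain ⟨i, o, hio⟩ := exists_restrict_not_isAndType (by lia) hf
    exact .of_restrict i o fun c => gramComputable_of_not_isAndType (hio c)

end FourBits

theorem theorem7 (n : ℕ) (f : BoolFun n) :
    exactQuantumQueryComplexity f = (n : ℕ∞) ↔ QueryIsomorphic f (andFun n) := by
  rw [queryIsomorphic_andFun_iff]
  constructor
  · intro hn
    by_contra hf
    cases n with
    | zero => exact hf ⟨f default, default, rfl, fun _ _ => Subsingleton.elim _ _⟩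
    | succ m =>
      have hle := (gramComputable_of_not_isAndType hf).exactQuantumQueryComplexity_le
      rw [hn, Nat.cast_le] at hle
      lia
  · exact fun hf => le_antisymm (gramComputable_self f).exactQuantumQueryComplexity_le
      hf.le_exactQuantumQueryComplexity
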